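/- All groups are discrete, and actions are actions on sets. For a finite set $A$ let $d(\sigma,\tau)=|\{a\in A:\sigma(a)\ne\tau(a)\}|/|A|$ be the normalized Hamming distance on $\mathrm{Sym}(A)$. An action $G\curvearrowright X$ of a group $G$ on a set $X$ is called \emph{sofic} if for all finite subsets $F\subseteq G$, $E\subseteq X$ and every $\epsilon>0$ there are a finite set $A$ and a map $\varphi:G\to\mathrm{Sym}(A)$ (not necessarily a homomorphism) such that (i) $\varphi(1_G)=1$; (ii) $d(\varphi(gh),\varphi(g)\varphi(h))<\epsilon$ for all $g,h\in F$; (iii) there are a finite set $B$, a subset $S\subseteq A$ with $|S|>(1-\epsilon)|A|$, and for each $s\in S$ an injective map $\pi_s:E\hookrightarrow B$, such that $\pi_{\varphi(g)s}(x)=\pi_s(g^{-1}x)$ for all $s\in S$, $g\in F$, $x\in E$ with $\varphi(g)s\in S$ and $g^{-1}x\in E$. A group $G$ is called \emph{amenable} if it satisfies Følner's condition: for every finite $F\subseteq G$ and $\epsilon>0$ there is a nonempty finite $K\subseteq G$ with $|gK\,\triangle\,K|\le\epsilon|K|$ for all $g\in F$. A group $G$ is called \emph{locally extended residually amenable (LERA)}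 if for every finitely generated subgroup $H\le G$ there is a decreasing sequence of subgroups $H_i\le G$ ($i\in\mathbb{N}$) with $H=\bigcap_i H_i$ such that, for each $i$, the quotient $G/\bigcap_{g\in G}gH_ig^{-1}$ of $G$ by the normal core of $H_i$ is amenable. It is called \emph{locally extended residually finite (LERF)} if for every finitely generated subgroup $H\le G$ there is a decreasing sequence of finite index subgroups $H_i\le G$ with $H=\bigcap_i H_i$. \textbf{Theorem.} Let $G$ be a group. (1) If $G$ is LERA, then every action of $G$ on a set is sofic. (2) If $G$ is the union of an increasing sequence $G_0\le G_1\le G_2\le\cdots$ of subgroups each of which is LERA, then every action of $G$ on a set is sofic. (3) If $G$ is LERF, then $G$ is LERA. (4) If $G$ is amenable, then $G$ is LERA. In particular, every action of a LERF group and every action of an amenable group on a set is sofic. -/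

import Mathlib

open scoped Pointwise symmDiff

universe u v

namespace SoficAction

/-- The normalized Hamming distance `|{a ∈ A : σ a ≠ τ a}| / |A|` on `Sym(A)`. -/
noncomputable def normHamming {A : Type} [Fintype A] [DecidableEq A]
    (σ τ : Equiv.Perm A) : ℝ :=
  (hammingDist (σ : A → A) (τ : A → A) : ℝ) / (Fintype.card A : ℝ)

/-- A map `φ : G → Sym(A)`, not necessarily a homomorphism, is unital if `φ 1 = 1`. -/
def IsUnital {G : Type u} [Group G] {A : Type} (φ : G → Equiv.Perm A) : Prop :=
  φ 1 = 1

/-- `φ` is `(F, ε)`-multiplicative: `d(φ(gh), φ(g)φ(h)) < ε` for all `g, h ∈ F`. -/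
def IsMultiplicativeOn {G : Type u} [Group G] {A : Type} [Fintype A] [DecidableEq A]
    (φ : G → Equiv.Perm A) (F : Finset G) (ε : ℝ) : Prop :=
  ∀ g ∈ F, ∀ h ∈ F, normHamming (φ (g * h)) (φ g * φ h) < ε

/-- `φ` is an `(F, E, ε)`-orbit approximation of the action of `G` on `X`: there are a finite set
`B`, a subset `S ⊆ A` with `|S| > (1 - ε)|A|` and injective maps `π s : E ↪ B`, for `s ∈ S`, such
that `π (φ(g)s) x = π s (g⁻¹x)` for `s ∈ S`, `g ∈ F`, `x ∈ E` whenever `φ(g)s ∈ S` and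
`g⁻¹x ∈ E`. -/
def IsOrbitApproximation {G : Type u} [Group G] {X : Type v} [MulAction G X]
    {A : Type} [Fintype A] (φ : G → Equiv.Perm A)
    (F : Finset G) (E : Finset X) (ε : ℝ) : Prop :=
  ∃ (B : Type) (_ : Finite B) (S : Finset A) (π : {s : A // s ∈ S} → ({x : X // x ∈ E} ↪ B)),
    (S.card : ℝ) > (1 - ε) * (Fintype.card A : ℝ) ∧
    ∀ (s : {s : A // s ∈ S}), ∀ g ∈ F, ∀ (x : {x : X // x ∈ E})
      (hs : φ g (s : A) ∈ S) (hx : g⁻¹ • (x : X) ∈ E),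
      π ⟨φ g (s : A), hs⟩ x = π s ⟨g⁻¹ • (x : X), hx⟩

/-- The action of the discrete group `G` on the set `X` is sofic. -/
def IsSofic (G : Type u) [Group G] (X : Type v) [MulAction G X] : Prop :=
  ∀ (F : Finset G) (E : Finset X) (ε : ℝ), 0 < ε →
    ∃ (A : Type) (_ : Fintype A) (_ : DecidableEq A) (φ : G → Equiv.Perm A),
      IsUnital φ ∧ IsMultiplicativeOn φ F ε ∧ IsOrbitApproximation φ F E ε

open Classical in
/-- Amenability of a discrete group, by Følner's condition: for every finite `F ⊆ G` and `ε > 0`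
there is a non-empty finite `K ⊆ G` with `|gK ∆ K| ≤ ε |K|` for all `g ∈ F`. -/
def IsAmenable (G : Type u) [Group G] : Prop :=
  ∀ (F : Finset G) (ε : ℝ), 0 < ε →
    ∃ K : Finset G, K.Nonempty ∧
      ∀ g ∈ F, (((g • K) ∆ K).card : ℝ) ≤ ε * (K.card : ℝ)

/-- `H` is strongly co-amenable in `G`: the quotient of `G` by the normal core
`⋂ g, g H g⁻¹` of `H` is amenable. -/
def IsStronglyCoamenable {G : Type u} [Group G] (H : Subgroup G) : Prop :=
  IsAmenable (G ⧸ H.normalCore)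

/-- Locally extended residually amenable groups: every finitely generated subgroup is the
intersection of a decreasing sequence of strongly co-amenable subgroups. -/
def IsLERA (G : Type u) [Group G] : Prop :=
  ∀ H : Subgroup G, H.FG →
    ∃ K : ℕ → Subgroup G, Antitone K ∧ (∀ i, IsStronglyCoamenable (K i)) ∧ H = ⨅ i, K i

/-- Locally extended residually finite groups: every finitely generated subgroup is the
intersection of a decreasing sequence of subgroups of finite index. -/
def IsLERF (G : Type u) [Group G] : Prop :=
  ∀ H : Subgroup G, H.FG →
    ∃ K : ℕ → Subgroup G, Antitone K ∧ (∀ i, (K i).FiniteIndex) ∧ H = ⨅ i, K i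

end SoficAction

/-!
The action of an amenable group `P` on any set `Y` is sofic for a simple reason: on a Følner set
`K ⊆ P`, left translation by `p` extends to a permutation of `K` which agrees with `k ↦ p * k` for
most `k ∈ K`, and the maps `π k : y ↦ k⁻¹ • y` satisfy the equivariance condition wherever the
permutations are honest translations. The same construction serves a group `G` with a homomorphism
`ρ : G →* P` and an injection `j` of a finite set `E ⊆ X` into `Y` that intertwines the partial
actions of a finite set `F ⊆ G` (`exists_approximation_of_isAmenable`).

For a LERA group `G` such a model of a finite part of `G ↷ X` is found orbit by orbit. Choose `t x`
carrying the base point of the orbit of `x` to `x`. The elements `(t (g⁻¹ • x))⁻¹ * g⁻¹ * t x`, with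
`g ∈ F` and `x ∈ E` in a given orbit, generate a finitely generated subgroup of the stabilizer of
the base point. It is contained in a strongly co-amenable subgroup `L` omitting the finitely many
elements `(t x)⁻¹ * t y` outside it (`IsLERA.exists_isStronglyCoamenable`), so that `x ↦ t x L` is
injective on the points of `E` in the orbit and intertwines the action of `F`. The product of the
groups `G ⧸ L.normalCore` over the orbits meeting `E` is amenable (`IsAmenable.pi`), and it acts on
the disjoint union of the coset spaces.

Soficity passes to increasing unions since only finitely many group elements are tested at a time.
Finite groups are amenable, hence LERF implies LERA. An amenable group is LERA through constant
sequences, because quotients of amenable groups are amenable (`IsAmenable.of_surjective`): the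
image of a Følner set, counted with multiplicities, has a level set which is a Følner set.
-/

namespace SoficAction

open Finset

/-! ### Amenable groups -/

open Classical in
/-- The two halves of `gK ∆ K` have the same cardinality, so Følner's condition only has to be
checked on the elements of `K` which `g` moves out of `K`. -/
theorem card_smul_symmDiff {G : Type*} [Group G] (g : G) (K : Finset G) :
    #((g • K) ∆ K) = 2 * #{k ∈ K | g * k ∉ K} := by
  have h1 : #((g • K) \ K) = #{k ∈ K | g * k ∉ K} := by
    rw [← Finset.card_smul_finset g {k ∈ K | g * k ∉ K}]
    congr 1
    ext x
    simp only [Finset.mem_sdiff, Finset.mem_smul_finset, Finset.mem_filter, smul_eq_mul]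
    constructor
    · rintro ⟨⟨y, hy, rfl⟩, h⟩
      exact ⟨y, ⟨hy, h⟩, rfl⟩
    · rintro ⟨y, ⟨hy, h⟩, rfl⟩
      exact ⟨⟨y, hy, rfl⟩, h⟩
  have h2 : #(K \ (g • K)) = #((g • K) \ K) :=
    Finset.card_sdiff_comm (Finset.card_smul_finset g K).symm
  rw [symmDiff_def, Finset.sup_eq_union, Finset.card_union_of_disjoint disjoint_sdiff_sdiff]
  omega

open Classical in
theorem isAmenable_iff {G : Type*} [Group G] :
    IsAmenable G ↔ ∀ (F : Finset G) (ε : ℝ), 0 < ε → ∃ K : Finset G, K.Nonempty ∧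
      ∀ g ∈ F, (#{k ∈ K | g * k ∉ K} : ℝ) ≤ ε * #K := by
  constructor
  · intro h F ε hε
    obtain ⟨K, hK, h⟩ := h F (2 * ε) (by positivity)
    refine ⟨K, hK, fun g hg => ?_⟩
    have := h g hg
    rw [card_smul_symmDiff] at this
    push_cast at this
    linarith
  · intro h F ε hε
    obtain ⟨K, hK, h⟩ := h F (ε / 2) (by positivity)
    refine ⟨K, hK, fun g hg => ?_⟩
    have := h g hg
    rw [card_smul_symmDiff]
    push_cast
    linarith

theorem IsAmenable.of_finite (G : Type*) [Group G] [Finite G] : IsAmenable G := by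
  classical
  have := Fintype.ofFinite G
  refine isAmenable_iff.2 fun F ε hε => ⟨univ, univ_nonempty, fun g _ => ?_⟩
  simp only [mem_univ, not_true_eq_false, filter_false, card_empty, Nat.cast_zero]
  positivity

theorem card_filter_piFinset_apply {ι : Type*} [Fintype ι] [DecidableEq ι] {α : ι → Type*}
    (K : ∀ i, Finset (α i)) (i : ι) (p : α i → Prop) [DecidablePred p] :
    #{k ∈ Fintype.piFinset K | p (k i)} = #{a ∈ K i | p a} * ∏ j ∈ univ.erase i, #(K j) := by
  have heq : {k ∈ Fintype.piFinset K | p (k i)}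
      = Fintype.piFinset (Function.update K i {a ∈ K i | p a}) := by
    ext k
    simp only [mem_filter, Fintype.mem_piFinset]
    constructor
    · rintro ⟨h1, h2⟩ j
      rcases eq_or_ne j i with rfl | hj
      · simpa using ⟨h1 j, h2⟩
      · simpa [Function.update_of_ne hj] using h1 j
    · intro h1
      have hi : k i ∈ K i ∧ p (k i) := by simpa using h1 i
      refine ⟨fun j => ?_, hi.2⟩
      rcases eq_or_ne j i with rfl | hj
      · exact hi.1
      · simpa [Function.update_of_ne hj] using h1 j
  rw [heq, Fintype.card_piFinset, ← mul_prod_erase univ _ (mem_univ i), Function.update_self]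
  congr 1
  exact prod_congr rfl fun j hj => by rw [Function.update_of_ne (ne_of_mem_erase hj)]

/-- A box of Følner sets is a Følner set: an element leaves the box only if one of its coordinates
leaves the corresponding side. -/
theorem IsAmenable.pi {ι : Type*} [Fintype ι] {P : ι → Type*} [∀ i, Group (P i)]
    (h : ∀ i, IsAmenable (P i)) : IsAmenable (∀ i, P i) := by
  classical
  refine isAmenable_iff.2 fun F ε hε => ?_
  set δ : ℝ := ε / (Fintype.card ι + 1) with hδ
  have hδ0 : 0 < δ := by positivity
  choose K hK hKF using fun i => isAmenable_iff.1 (h i) (F.image fun p => p i) δ hδ0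
  refine ⟨Fintype.piFinset K, Fintype.piFinset_nonempty.2 hK, fun g hg => ?_⟩
  have hside : ∀ i, (#{k ∈ Fintype.piFinset K | g i * k i ∉ K i} : ℝ)
      ≤ δ * #(Fintype.piFinset K) := by
    intro i
    rw [card_filter_piFinset_apply K i (fun a => g i * a ∉ K i), Fintype.card_piFinset,
      ← mul_prod_erase univ (fun j => #(K j)) (mem_univ i)]
    push_cast
    rw [← mul_assoc]
    exact mul_le_mul_of_nonneg_right (hKF i (g i) (mem_image_of_mem _ hg))
      (prod_nonneg fun _ _ => Nat.cast_nonneg _)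
  have hsub : {k ∈ Fintype.piFinset K | g * k ∉ Fintype.piFinset K}
      ⊆ univ.biUnion fun i => {k ∈ Fintype.piFinset K | g i * k i ∉ K i} := by
    intro k hk
    simp only [mem_filter, Fintype.mem_piFinset, Pi.mul_apply, not_forall, mem_biUnion, mem_univ,
      true_and] at hk ⊢
    obtain ⟨h1, i, hi⟩ := hk
    exact ⟨i, h1, hi⟩
  have hcard := (card_le_card hsub).trans card_biUnion_le
  have hsum := sum_le_sum fun i (_ : i ∈ univ) => hside i
  rw [sum_const, card_univ, nsmul_eq_mul, ← mul_assoc] at hsum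
  have hδε : Fintype.card ι * δ ≤ ε := by
    rw [hδ, mul_div_assoc', div_le_iff₀ (by positivity)]
    linarith
  refine le_trans ?_ (hsum.trans (mul_le_mul_of_nonneg_right hδε (Nat.cast_nonneg _)))
  rw [← Nat.cast_sum]
  -- The two sides decide equality in the product group by different instances.
  refine Nat.cast_le.2 (le_trans (le_of_eq ?_) hcard)
  congr!

/-- The image of a Følner set `K` under a surjection defines a function counting the points of `K`
in each fibre. Its superlevel sets satisfy Følner's condition on average, so one of them does. -/
theorem IsAmenable.of_surjective {G Q : Type*} [Group G] [Group Q] (h : IsAmenable G)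
    (f : G →* Q) (hf : Function.Surjective f) : IsAmenable Q := by
  classical
  refine isAmenable_iff.2 fun F ε hε => ?_
  obtain ⟨r, hr⟩ := hf.hasRightInverse
  set δ : ℝ := ε / (#F + 1) with hδ
  have hδ0 : 0 < δ := by positivity
  obtain ⟨K, hK, hKF⟩ := isAmenable_iff.1 h (F.image r) δ hδ0
  set n : Q → ℕ := fun q => #{k ∈ K | f k = q} with hn
  set L : ℕ → Finset Q := fun t => {q ∈ K.image f | t < n q} with hL
  have hnle : ∀ q, n q ≤ #K := fun q => card_filter_le _ _
  have memL : ∀ t q, q ∈ L t ↔ t < n q := by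
    intro t q
    simp only [hL, mem_filter, mem_image, and_iff_right_iff_imp]
    intro hq
    obtain ⟨k, hk⟩ := card_pos.1 (lt_of_le_of_lt (Nat.zero_le t) hq)
    exact ⟨k, mem_filter.1 hk⟩
  -- The layer-cake formula for the total mass `#K`.
  have hmass : ∑ t ∈ range #K, #(L t) = #K := by
    simp only [hL, card_filter]
    rw [sum_comm]
    refine Eq.trans ?_ (card_eq_sum_card_image f K).symm
    refine sum_congr rfl fun q _ => ?_
    rw [← card_filter]
    have : {t ∈ range #K | t < n q} = range (n q) := by
      ext t
      have := hnle q
      simp only [mem_filter, mem_range]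
      omega
    rw [this, card_range]
  have hdefect : ∀ g ∈ F, ∑ t ∈ range #K, #{q ∈ L t | g * q ∉ L t} ≤ #{k ∈ K | r g * k ∉ K} := by
    intro g _
    have h1 : ∀ t, #{q ∈ L t | g * q ∉ L t}
        = ∑ q ∈ K.image f, if n (g * q) ≤ t ∧ t < n q then 1 else 0 := by
      intro t
      rw [← card_filter]
      congr 1
      ext q
      simp only [mem_filter, memL, not_lt]
      constructor
      · rintro ⟨h1, h2⟩
        exact ⟨(mem_filter.1 ((memL t q).2 h1)).1, h2, h1⟩
      · rintro ⟨_, h2, h1⟩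
        exact ⟨h1, h2⟩
    simp only [h1]
    rw [sum_comm, card_eq_sum_card_fiberwise (f := f) (t := K.image f)
      (fun k hk => mem_image_of_mem f (mem_filter.1 hk).1)]
    refine sum_le_sum fun q _ => ?_
    rw [← card_filter]
    have h2 : {t ∈ range #K | n (g * q) ≤ t ∧ t < n q} = Ico (n (g * q)) (n q) := by
      ext t
      have := hnle q
      simp only [mem_filter, mem_range, mem_Ico]
      omega
    rw [h2, Nat.card_Ico]
    -- Points of the fibre over `q` that stay in `K` inject into the fibre over `g * q`.
    have h3 : #{k ∈ {k ∈ K | f k = q} | r g * k ∈ K} ≤ n (g * q) := by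
      refine card_le_card_of_injOn (fun k => r g * k) (fun k hk => ?_)
        (fun a _ b _ hab => mul_left_cancel hab)
      simp only [coe_filter, mem_filter, Set.mem_ofPred_eq] at hk ⊢
      exact ⟨hk.2, by rw [map_mul, hr g, hk.1.2]⟩
    have h4 := card_filter_add_card_filter_not (s := {k ∈ K | f k = q}) (fun k => r g * k ∈ K)
    have h5 : #{k ∈ {k ∈ K | f k = q} | r g * k ∉ K} = #{k ∈ {k ∈ K | r g * k ∉ K} | f k = q} := by
      rw [filter_comm]
    have h6 : n q = #{k ∈ K | f k = q} := rfl
    omega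
  by_contra hcon
  push Not at hcon
  have hbig : ∀ t ∈ range #K, ε * #(L t) ≤ ∑ g ∈ F, (#{q ∈ L t | g * q ∉ L t} : ℝ) := by
    intro t _
    rcases (L t).eq_empty_or_nonempty with h0 | h0
    · simp [h0]
    · obtain ⟨g, hg, hlt⟩ := hcon (L t) h0
      exact hlt.le.trans (single_le_sum (f := fun g => (#{q ∈ L t | g * q ∉ L t} : ℝ))
        (fun _ _ => by positivity) hg)
  have hK0 : (0 : ℝ) < #K := by exact_mod_cast hK.card_pos
  have : ε * #K ≤ (#F * δ) * #K := by
    calc ε * #K = ∑ t ∈ range #K, ε * (#(L t) : ℝ) := by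
          rw [← mul_sum]
          exact_mod_cast congrArg (fun m : ℕ => ε * (m : ℝ)) hmass.symm
      _ ≤ ∑ t ∈ range #K, ∑ g ∈ F, (#{q ∈ L t | g * q ∉ L t} : ℝ) := sum_le_sum hbig
      _ = ∑ g ∈ F, ∑ t ∈ range #K, (#{q ∈ L t | g * q ∉ L t} : ℝ) := sum_comm
      _ ≤ ∑ _g ∈ F, δ * #K := sum_le_sum fun g hg =>
          le_trans (by exact_mod_cast hdefect g hg) (hKF (r g) (mem_image_of_mem r hg))
      _ = (#F * δ) * #K := by rw [sum_const, nsmul_eq_mul, mul_assoc]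
  have h7 : ε ≤ #F * δ := le_of_mul_le_mul_right this hK0
  rw [hδ, mul_div_assoc', le_div_iff₀ (by positivity)] at h7
  linarith

/-! ### Sofic approximations from Følner sets -/

/-- Left translation by `p`, where it maps a finite set to itself, extends to a permutation. -/
theorem exists_perm_extending_mul {P : Type*} [Group P] {A : Type*} [Fintype A] {K : Finset P}
    (e : A ≃ K) (p : P) :
    ∃ σ : Equiv.Perm A, ∀ s, p * (e s : P) ∈ K → (e (σ s) : P) = p * e s := by
  classical
  obtain ⟨τ, hτ⟩ := Finset.exists_equiv_extend_of_card_eq (t := K)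
    (s := univ.filter fun s : A => p * (e s : P) ∈ K) (f := fun s => p * (e s : P))
    (by rw [Fintype.card_congr e, Fintype.card_coe])
    (by
      intro q hq
      obtain ⟨s, hs, rfl⟩ := mem_image.1 hq
      exact (mem_filter.1 hs).2)
    (fun a _ b _ hab => e.injective (Subtype.ext (mul_left_cancel hab)))
  refine ⟨τ.trans e.symm, fun s hs => ?_⟩
  simpa using hτ s (by simpa using hs)

/-- A finite part `F`, `E` of an action of `G` that is modelled, through `ρ` and `j`, on an action
of an amenable group has sofic approximations. -/
theorem exists_approximation_of_isAmenable {G : Type u} [Group G] {X : Type v} [MulAction G X]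
    {P Y : Type*} [Group P] [MulAction P Y] (hP : IsAmenable P) (ρ : G →* P)
    (F : Finset G) (E : Finset X) (j : {x : X // x ∈ E} ↪ Y)
    (hj : ∀ g ∈ F, ∀ (x : {x : X // x ∈ E}) (hx : g⁻¹ • (x : X) ∈ E),
      j ⟨g⁻¹ • (x : X), hx⟩ = (ρ g)⁻¹ • j x)
    {ε : ℝ} (hε : 0 < ε) :
    ∃ (A : Type) (_ : Fintype A) (_ : DecidableEq A) (φ : G → Equiv.Perm A),
      IsUnital φ ∧ IsMultiplicativeOn φ F ε ∧ IsOrbitApproximation φ F E ε := by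
  classical
  set δ : ℝ := ε / (#F + 3) with hδ
  have hδ0 : 0 < δ := by positivity
  have hδε : (#F + 3) * δ = ε := by rw [hδ]; field_simp
  obtain ⟨K, hK, hKF⟩ := isAmenable_iff.1 hP ((F ∪ F * F).image ρ) δ hδ0
  have hK0 : (0 : ℝ) < #K := by exact_mod_cast hK.card_pos
  let e : Fin #K ≃ K := K.equivFin.symm
  have hbad : ∀ g ∈ F ∪ F * F,
      (#{s : Fin #K | ρ g * (e s : P) ∉ K} : ℝ) ≤ δ * #K := by
    intro g hg
    refine le_trans ?_ (hKF (ρ g) (mem_image_of_mem ρ hg))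
    norm_cast
    refine card_le_card_of_injOn (fun s => (e s : P)) (fun s hs => ?_)
      (fun a _ b _ hab => e.injective (Subtype.ext hab))
    simpa using hs
  choose σ' hσ' using exists_perm_extending_mul e
  obtain ⟨σ, hσ1, hσ⟩ : ∃ σ : P → Equiv.Perm (Fin #K), σ 1 = 1 ∧
      ∀ p s, p * (e s : P) ∈ K → (e (σ p s) : P) = p * e s := by
    refine ⟨fun p => if p = 1 then 1 else σ' p, if_pos rfl, fun p s hs => ?_⟩
    by_cases hp : p = 1
    · simp [hp]
    · simpa [hp] using hσ' p s hs
  refine ⟨Fin #K, inferInstance, inferInstance, fun g => σ (ρ g), ?_, ?_, ?_⟩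
  · simpa [IsUnital] using hσ1
  · intro g hg h hh
    have hsub : ({s | (σ (ρ (g * h)) : Fin #K → Fin #K) s ≠ (σ (ρ g) * σ (ρ h)) s} : Finset _)
        ⊆ univ.filter (fun s => ρ h * (e s : P) ∉ K)
          ∪ univ.filter (fun s => ρ (g * h) * (e s : P) ∉ K) := by
      intro s hs
      simp only [mem_filter, mem_univ, true_and, mem_union] at hs ⊢
      by_contra! hcon
      obtain ⟨h1, h2⟩ := hcon
      refine hs (e.injective (Subtype.ext ?_))
      have h3 : (e (σ (ρ h) s) : P) = ρ h * e s := hσ _ _ h1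
      have h4 : ρ g * (e (σ (ρ h) s) : P) ∈ K := by
        rwa [h3, ← mul_assoc, ← map_mul]
      rw [hσ _ _ h2, Equiv.Perm.mul_apply, hσ _ _ h4, h3, map_mul, mul_assoc]
    have hcard : (hammingDist (σ (ρ (g * h)) : Fin #K → Fin #K) (σ (ρ g) * σ (ρ h) : Equiv.Perm _)
        : ℝ) ≤ δ * #K + δ * #K := by
      refine le_trans ?_ (add_le_add (hbad h (mem_union_left _ hh))
        (hbad (g * h) (mem_union_right _ (mul_mem_mul hg hh))))
      exact_mod_cast (card_le_card hsub).trans (card_union_le _ _)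
    rw [normHamming, Fintype.card_fin, div_lt_iff₀ hK0]
    refine lt_of_le_of_lt hcard ?_
    rw [← add_mul]
    refine mul_lt_mul_of_pos_right ?_ hK0
    have : (0 : ℝ) ≤ #F * δ := by positivity
    linarith
  · -- The values of `π` lie in the finite set `K⁻¹ • j E`, enumerated to land in `Type`.
    let B : Finset Y := univ.image fun sx : Fin #K × {x : X // x ∈ E} => (e sx.1 : P)⁻¹ • j sx.2
    have hB : ∀ s x, (e s : P)⁻¹ • j x ∈ B := fun s x =>
      mem_image.2 ⟨(s, x), mem_univ _, rfl⟩
    refine ⟨Fin #B, inferInstance, univ.filter fun s => ∀ g ∈ F, ρ g * (e s : P) ∈ K,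
      fun s => ⟨fun x => B.equivFin ⟨_, hB s x⟩, fun x y hxy => ?_⟩, ?_, ?_⟩
    · simpa using hxy
    · have hcompl : ({s | ∀ g ∈ F, ρ g * (e s : P) ∈ K} : Finset (Fin #K))ᶜ
          ⊆ F.biUnion fun g => {s | ρ g * (e s : P) ∉ K} := by
        intro s hs
        simpa using hs
      have h1 : (#({s | ∀ g ∈ F, ρ g * (e s : P) ∈ K} : Finset (Fin #K))ᶜ : ℝ)
          ≤ #F * (δ * #K) := by
        calc (#({s | ∀ g ∈ F, ρ g * (e s : P) ∈ K} : Finset (Fin #K))ᶜ : ℝ)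
            ≤ ∑ g ∈ F, (#{s : Fin #K | ρ g * (e s : P) ∉ K} : ℝ) := by
              exact_mod_cast (card_le_card hcompl).trans card_biUnion_le
          _ ≤ ∑ _g ∈ F, δ * #K := sum_le_sum fun g hg => hbad g (mem_union_left _ hg)
          _ = #F * (δ * #K) := by rw [sum_const, nsmul_eq_mul]
      have h2 : (#({s | ∀ g ∈ F, ρ g * (e s : P) ∈ K} : Finset (Fin #K)) : ℝ)
          + #({s | ∀ g ∈ F, ρ g * (e s : P) ∈ K} : Finset (Fin #K))ᶜ = #K := by
        exact_mod_cast (card_add_card_compl _).trans (Fintype.card_fin _)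
      have h3 : 0 < δ * #K := by positivity
      rw [Fintype.card_fin, ← hδε]
      linarith
    · intro s g hg x hs hx
      have h1 : (e (σ (ρ g) s) : P) = ρ g * e s :=
        hσ _ _ ((mem_filter.1 s.2).2 g hg)
      refine congrArg B.equivFin (Subtype.ext ?_)
      change (e (σ (ρ g) s) : P)⁻¹ • j x = (e s : P)⁻¹ • j _
      rw [h1, hj g hg x hx, mul_inv_rev, mul_smul]

/-! ### Actions of LERA groups -/

/-- Finitely many elements outside a finitely generated subgroup can be separated from it by one
strongly co-amenable subgroup. -/
theorem IsLERA.exists_isStronglyCoamenable {G : Type u} [Group G] (hG : IsLERA G)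
    {H : Subgroup G} (hH : H.FG) (T : Finset G) :
    ∃ L : Subgroup G, IsStronglyCoamenable L ∧ H ≤ L ∧ ∀ a ∈ T, a ∈ L → a ∈ H := by
  obtain ⟨K, hanti, hK, rfl⟩ := hG H hH
  have hsep : ∀ a, ∃ i, a ∈ K i → a ∈ ⨅ i, K i := by
    intro a
    by_cases ha : a ∈ ⨅ i, K i
    · exact ⟨0, fun _ => ha⟩
    · rw [Subgroup.mem_iInf, not_forall] at ha
      obtain ⟨i, hi⟩ := ha
      exact ⟨i, fun h => absurd h hi⟩
  choose i hi using hsep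
  exact ⟨K (T.sup i), hK _, iInf_le _ _, fun a ha haK => hi a (hanti (le_sup ha) haK)⟩

theorem sigma_quotient_mk_eq_iff {P ι : Type*} [Group P] {L : ι → Subgroup P} {i i' : ι}
    {a b : P} :
    (⟨i, (a : P ⧸ L i)⟩ : Σ i, P ⧸ L i) = ⟨i', (b : P ⧸ L i')⟩ ↔ i = i' ∧ a⁻¹ * b ∈ L i := by
  constructor
  · intro h
    obtain ⟨rfl, h⟩ := Sigma.mk.inj_iff.1 h
    exact ⟨rfl, QuotientGroup.eq.1 (eq_of_heq h)⟩
  · rintro ⟨rfl, h⟩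
    rw [QuotientGroup.eq.2 h]

theorem IsLERA.isSofic {G : Type u} [Group G] (hG : IsLERA G) (X : Type v) [MulAction G X] :
    IsSofic G X := by
  classical
  intro F E ε hε
  let orb : X → MulAction.orbitRel.Quotient G X := Quotient.mk''
  have horb : ∀ (g : G) (x : X), orb (g • x) = orb x := fun g x =>
    Quotient.sound' (MulAction.mem_orbit x g)
  have htrans : ∀ x : X, ∃ g : G, g • (orb x).out = x := by
    intro x
    have h : orb (orb x).out = orb x := Quotient.out_eq' _
    exact MulAction.mem_orbit_iff.1 (MulAction.orbitRel_apply.1 (Quotient.exact' h.symm))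
  choose t ht using htrans
  -- The elements witnessing the partial action of `F` on the orbit `o`.
  let W : MulAction.orbitRel.Quotient G X → Finset G := fun o =>
    ((F ×ˢ E).filter fun gx => orb gx.2 = o).image fun gx =>
      (t (gx.1⁻¹ • gx.2))⁻¹ * (gx.1⁻¹ * t gx.2)
  have hWstab : ∀ o, Subgroup.closure (W o : Set G) ≤ MulAction.stabilizer G o.out := by
    intro o
    rw [Subgroup.closure_le]
    intro a ha
    obtain ⟨⟨g, x⟩, hgx, rfl⟩ := mem_image.1 (mem_coe.1 ha)
    obtain rfl : orb x = o := (mem_filter.1 hgx).2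
    have h := ht (g⁻¹ • x)
    rw [horb] at h
    rw [SetLike.mem_coe, MulAction.mem_stabilizer_iff, mul_smul, mul_smul, ht x, inv_smul_eq_iff, h]
  choose L hLamen hLW hLT using fun o => hG.exists_isStronglyCoamenable
    ((Subgroup.fg_iff _).2 ⟨(W o : Set G), rfl, (W o).finite_toSet⟩)
    ((E ×ˢ E).image fun xy => (t xy.1)⁻¹ * t xy.2)
  -- Each coset space `G ⧸ L o` is realised as a quotient of the full product `∏ o, P o`, so that the
  -- product acts on their disjoint union.
  let ι : Type _ := {o // o ∈ E.image orb}
  let P : ι → Type _ := fun o => G ⧸ (L o).normalCore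
  let ρ : G →* (∀ o, P o) := MonoidHom.pi fun o => QuotientGroup.mk' (L o).normalCore
  let M : ι → Subgroup (∀ o, P o) := fun o =>
    ((L o).map (QuotientGroup.mk' (L o).normalCore)).comap (Pi.evalMonoidHom P o)
  have hM : ∀ (o : ι) (g : G), ρ g ∈ M o ↔ g ∈ L o := by
    intro o g
    change QuotientGroup.mk' (L o).normalCore g ∈ (L o).map (QuotientGroup.mk' (L o).normalCore) ↔ _
    rw [← Subgroup.mem_comap, Subgroup.comap_map_eq, QuotientGroup.ker_mk',
      sup_eq_left.2 (Subgroup.normalCore_le _)]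
  let c : {x : X // x ∈ E} → ι := fun x => ⟨orb x, mem_image_of_mem orb x.2⟩
  have hinj : Function.Injective
      fun x : {x : X // x ∈ E} => (⟨c x, (ρ (t x) : (∀ o, P o) ⧸ M (c x))⟩ : Σ o, _ ⧸ M o) := by
    intro x y hxy
    obtain ⟨hc, h⟩ := sigma_quotient_mk_eq_iff.1 hxy
    rw [← map_inv, ← map_mul, hM] at h
    have hcx : orb x = orb y := congrArg Subtype.val hc
    have h1 := hWstab _ (hLT _ _
      (mem_image.2 ⟨((x : X), (y : X)), mem_product.2 ⟨x.2, y.2⟩, rfl⟩) h)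
    rw [MulAction.mem_stabilizer_iff, mul_smul, inv_smul_eq_iff] at h1
    have h2 : t (y : X) • (orb x).out = y := by rw [hcx]; exact ht y
    exact Subtype.ext ((ht x).symm.trans (h1.symm.trans h2))
  refine exists_approximation_of_isAmenable (IsAmenable.pi fun o : ι => hLamen o) ρ F E
    ⟨_, hinj⟩ (fun g hg x hx => ?_) hε
  refine sigma_quotient_mk_eq_iff (b := (ρ g)⁻¹ * ρ (t x)).2 ⟨Subtype.ext (horb _ _), ?_⟩
  rw [← map_inv, ← map_inv, ← map_mul, ← map_mul, hM]
  refine hLW _ (Subgroup.subset_closure (mem_coe.2 (mem_image.2 ⟨(g, x), ?_, rfl⟩)))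
  exact mem_filter.2 ⟨mem_product.2 ⟨hg, x.2⟩, (horb _ _).symm⟩

/-! ### Increasing unions, finite index subgroups, amenable groups -/

/-- An action is sofic if every finite subset of the group lies in a subgroup acting soficly. An
approximation for the subgroup extends to the whole group by the trivial permutation. -/
theorem isSofic_of_forall_finset_subset_subgroup {G : Type u} [Group G] {X : Type v} [MulAction G X]
    (h : ∀ F : Finset G, ∃ H : Subgroup G, (F : Set G) ⊆ H ∧ IsSofic H X) : IsSofic G X := by
  classical
  intro F E ε hε
  obtain ⟨H, hFH, hH⟩ := h F
  obtain ⟨A, hA, hA', φ, hφ1, hφ2, B, hB, S, π, hS, hπ⟩ :=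
    hH (F.subtype (· ∈ H)) E ε hε
  have hext : ∀ g (hg : g ∈ H), (if h : g ∈ H then φ ⟨g, h⟩ else 1) = φ ⟨g, hg⟩ := fun g hg =>
    dif_pos hg
  refine ⟨A, hA, hA', fun g => if h : g ∈ H then φ ⟨g, h⟩ else 1, ?_, ?_, B, hB, S, π, hS, ?_⟩
  · exact (hext 1 H.one_mem).trans hφ1
  · intro g hg k hk
    have hgH : g ∈ H := hFH hg
    have hkH : k ∈ H := hFH hk
    beta_reduce
    rw [hext _ (H.mul_mem hgH hkH), hext _ hgH, hext _ hkH]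
    exact hφ2 ⟨g, hgH⟩ (mem_subtype.2 hg) ⟨k, hkH⟩ (mem_subtype.2 hk)
  · intro s g hg x hs hx
    have hgH : g ∈ H := hFH hg
    simp only [hext g hgH] at hs ⊢
    exact hπ s ⟨g, hgH⟩ (mem_subtype.2 hg) x hs hx

theorem isSofic_of_iUnion_isLERA {G : Type u} [Group G] (K : ℕ → Subgroup G) (hK : Monotone K)
    (hU : (⋃ i, (K i : Set G)) = Set.univ) (hL : ∀ i, IsLERA (K i)) (X : Type v) [MulAction G X] :
    IsSofic G X := by
  refine isSofic_of_forall_finset_subset_subgroup fun F => ?_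
  have hmem : ∀ g : G, ∃ i, g ∈ K i := fun g => Set.mem_iUnion.1 (hU ▸ Set.mem_univ g)
  choose i hi using hmem
  exact ⟨K (F.sup i), fun g hg => hK (le_sup (mem_coe.1 hg)) (hi g), (hL _).isSofic X⟩

theorem IsLERF.isLERA {G : Type u} [Group G] (h : IsLERF G) : IsLERA G := by
  intro H hH
  obtain ⟨K, hanti, hfin, hKH⟩ := h H hH
  refine ⟨K, hanti, fun i => ?_, hKH⟩
  have := hfin i
  exact IsAmenable.of_finite _

theorem IsAmenable.isLERA {G : Type u} [Group G] (h : IsAmenable G) : IsLERA G := fun H _ =>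
  ⟨fun _ => H, antitone_const,
    fun _ => h.of_surjective (QuotientGroup.mk' H.normalCore) (QuotientGroup.mk'_surjective _),
    ciInf_const.symm⟩

end SoficAction

theorem mainTheorem3 (G : Type u) [Group G] :
    (SoficAction.IsLERA G →
      ∀ (X : Type v) [MulAction G X], SoficAction.IsSofic G X) ∧
    (∀ K : ℕ → Subgroup G, Monotone K → (⋃ i, (K i : Set G)) = Set.univ →
      (∀ i, SoficAction.IsLERA (K i)) →
      ∀ (X : Type v) [MulAction G X], SoficAction.IsSofic G X) ∧
    (SoficAction.IsLERF G → SoficAction.IsLERA G) ∧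
    (SoficAction.IsAmenable G → SoficAction.IsLERA G) :=
  ⟨fun h X _ => h.isSofic X,
    fun K hK hU hL X _ => SoficAction.isSofic_of_iUnion_isLERA K hK hU hL X,
    fun h => h.isLERA, fun h => h.isLERA⟩
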